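/- Let $N\ge 2$ and let $\Omega\subset\mathbb{R}^N$ be a bounded domain (nonempty connected open set) with boundary of class $C^2$, that is, near each boundary point $\Omega$ is the region lying on one side of the graph of a $C^2$ function. For $x\in\partial\Omega$ let $H(x)=\frac{k_1(x)+\dots+k_{N-1}(x)}{N-1}$ be the mean curvature, where $k_1(x),\dots,k_{N-1}(x)$ are the principal curvatures of $\partial\Omega$ at $x$, i.e. the eigenvalues of the differential of the exterior unit normal on the tangent space (so $H=1/R$ for a ball of radius $R$). Let $H^-=\max\{-H,0\}$, let $|\Omega'|$ denote the $N$-dimensional Lebesgue measure of $\Omega'\subset\mathbb{R}^N$, and let $|\partial\Omega|$ denote the surface measure, i.e. the $(N-1)$-dimensional Hausdorff measure, of $\partial\Omega$. Then $\mathcal{M}_0^-:=\max_{\partial\Omega}H^-$ exists, $|\partial\Omega|<\infty$, and for every $\eta>0$ $$\left|\left\{x\in\Omega : \mathrm{dist}(x,\partial\Omega)\le\eta\right\}\right|\le\left(1+\eta\,\mathcal{M}_0^-\right)^{N-1}\,|\partial\Omega|\,\eta .$$ -/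

import Mathlib

open MeasureTheory Metric Topology
open scoped Gradient

/-- `Ω ⊂ ℝ^N` has boundary of class `C²`: near every boundary point `x` there is a unit direction
`e` such that `Ω` coincides with the region lying below the graph, in the direction `e`, of a
function of class `C²` defined on the hyperplane `e^⊥`. -/
def HasC2Boundary {N : ℕ} (Ω : Set (EuclideanSpace ℝ (Fin N))) : Prop :=
  ∀ x ∈ frontier Ω, ∃ e : EuclideanSpace ℝ (Fin N), ‖e‖ = 1 ∧
    ∃ f : (ℝ ∙ e)ᗮ → ℝ, ContDiffAt ℝ 2 f ((ℝ ∙ e)ᗮ.orthogonalProjectionOnto x) ∧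
      ∀ᶠ y in 𝓝 x, y ∈ Ω ↔ inner ℝ e y < f ((ℝ ∙ e)ᗮ.orthogonalProjectionOnto y)

/-- `φ` is a `C²` defining function of `Ω` near `x`: `Ω = {φ < 0}` near `x`, and `φ` is of class
`C²` near `x` and vanishes at `x`, with nonzero gradient there. -/
structure IsC2DefiningFunctionAt {N : ℕ} (Ω : Set (EuclideanSpace ℝ (Fin N)))
    (x : EuclideanSpace ℝ (Fin N)) (φ : EuclideanSpace ℝ (Fin N) → ℝ) : Prop where
  contDiffAt : ContDiffAt ℝ 2 φ x
  eq_zero : φ x = 0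
  gradient_ne_zero : ∇ φ x ≠ 0
  mem_iff : ∀ᶠ y in 𝓝 x, y ∈ Ω ↔ φ y < 0

/-- The unit normal field `∇φ / |∇φ|` to the level sets of `φ`. If `φ` is a defining function of
`Ω`, its restriction to `∂Ω` is the exterior unit normal. -/
noncomputable def unitNormal {N : ℕ} (φ : EuclideanSpace ℝ (Fin N) → ℝ)
    (y : EuclideanSpace ℝ (Fin N)) : EuclideanSpace ℝ (Fin N) :=
  ‖∇ φ y‖⁻¹ • ∇ φ y

/-- The tangent space at `x` to the level set of `φ` through `x`. -/
noncomputable abbrev tangentHyperplane {N : ℕ} (φ : EuclideanSpace ℝ (Fin N) → ℝ)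
    (x : EuclideanSpace ℝ (Fin N)) : Submodule ℝ (EuclideanSpace ℝ (Fin N)) :=
  (ℝ ∙ ∇ φ x)ᗮ

/-- The shape operator (Weingarten map) at `x`: the derivative of the unit normal, as an
endomorphism of the tangent space. (The derivative of a unit field in a tangential direction is
already tangential; the projection only adjusts the codomain.) -/
noncomputable def shapeOperator {N : ℕ} (φ : EuclideanSpace ℝ (Fin N) → ℝ)
    (x : EuclideanSpace ℝ (Fin N)) : tangentHyperplane φ x →ₗ[ℝ] tangentHyperplane φ x :=
  ((tangentHyperplane φ x).orthogonalProjectionOnto ∘L fderiv ℝ (unitNormal φ) x ∘L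
    (tangentHyperplane φ x).subtypeL).toLinearMap

open Classical in
/-- The principal curvatures of `∂Ω` at `x`: the eigenvalues, with multiplicity, of the shape
operator associated with the exterior unit normal (so they are positive for a ball). They are
computed with any `C²` defining function of `Ω` near `x`; the result does not depend on it. The
default value `0` is used only where there is no such function. -/
noncomputable def principalCurvatures {N : ℕ} (Ω : Set (EuclideanSpace ℝ (Fin N)))
    (x : EuclideanSpace ℝ (Fin N)) : Multiset ℝ :=
  if h : ∃ φ, IsC2DefiningFunctionAt Ω x φ then (shapeOperator h.choose x).charpoly.roots else 0

/-- The mean curvature `H = (k₁ + ⋯ + k_{N-1}) / (N - 1)` of `∂Ω` at `x`. -/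
noncomputable def meanCurvature {N : ℕ} (Ω : Set (EuclideanSpace ℝ (Fin N)))
    (x : EuclideanSpace ℝ (Fin N)) : ℝ :=
  (principalCurvatures Ω x).sum / ((N : ℝ) - 1)

/-- The negative part `H⁻ = max {-H, 0}` of the mean curvature. -/
noncomputable def meanCurvatureNeg {N : ℕ} (Ω : Set (EuclideanSpace ℝ (Fin N)))
    (x : EuclideanSpace ℝ (Fin N)) : ℝ :=
  max (-meanCurvature Ω x) 0

/-- `M₀⁻`, the maximum over `∂Ω` of the negative part of the mean curvature. -/
noncomputable def maxMeanCurvatureNeg {N : ℕ} (Ω : Set (EuclideanSpace ℝ (Fin N))) : ℝ :=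
  sSup (meanCurvatureNeg Ω '' frontier Ω)

/-!
The estimate is the inequality of Heintze and Karcher for inner tubes, proved by bounding the
Jacobian determinant of the normal map `(y, t) ↦ y - t ν(y)`, where `ν` is the exterior unit normal.

A point `z ∈ Ω` with nearest boundary point `y` at distance `t` is `y - t ν(y)`, because the ball of
radius `t` about `z` is contained in `Ω` and touches the boundary at `y`
(`unitNormal_eq_of_ball_subset`). The second derivative test along curves in this ball bounds all
principal curvatures at `y` by `1 / t` (`inner_fderiv_unitNormal_le_of_ball_subset`). So the factors
of the Jacobian determinant `∏ (1 - t kᵢ)` of the normal map are nonnegative, and the inequality of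
arithmetic and geometric means bounds it by `(1 - t H(y)) ^ (N - 1)`, hence by
`(1 + η M₀⁻) ^ (N - 1)` (`det_id_sub_smul_extendedShapeOperator_bounds`).

Only an upper bound for the volume is needed, so neither an area formula on the boundary nor
injectivity of the normal map is required. Fix `ε > 0` and a boundary point `x`, and write the
boundary near `x` as the image of the tangent hyperplane under a diffeomorphism tangent to the
identity (`exists_chart`). In this chart the determinant of the normal map on the normal line at `x`
is exactly `∏ (1 - t kᵢ(x))`, so by continuity and compactness it is at most
`(1 + η M₀⁻) ^ (N - 1) + ε` at all relevant points over a neighbourhood of `x`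
(`exists_thickening_abs_det_fderiv_normalMap_le`). The tube over a small piece `A` of the boundary
is therefore covered by the image of a set whose slices parallel to the
hyperplane are 1-Lipschitz images of subsets of `A`, which gives the local estimate
(`exists_nhds_volume_innerTube_le`). Since the boundary is compact, the local estimates add up, and
`ε` tends to `0`.

The maximum of `H⁻` exists because `H` is continuous on the boundary: near a boundary point one
defining function serves all boundary points, and the shape operator does not depend on the choice
of the defining function (`extendedShapeOperator_eq`).
-/

/-! ### Linear algebra -/

theorem inv_norm_smul_eq_of_halfspace_subset {V : Type*} [NormedAddCommGroup V]
    [InnerProductSpace ℝ V] {a g : V} (ha : a ≠ 0) (hg : g ≠ 0)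
    (h : ∀ v, inner ℝ a v < 0 → inner ℝ g v ≤ 0) : ‖g‖⁻¹ • g = ‖a‖⁻¹ • a := by
  have ha' : 0 < ‖a‖ := norm_pos_iff.2 ha
  have hg' : 0 < ‖g‖ := norm_pos_iff.2 hg
  have key : inner ℝ g a = ‖g‖ * ‖a‖ := by
    refine le_antisymm (real_inner_le_norm g a) ?_
    by_contra! hlt
    -- unless `a` and `g` are parallel, `g / |g| - a / |a|` contradicts the hypothesis
    have h1 : inner ℝ a (‖g‖⁻¹ • g - ‖a‖⁻¹ • a) < 0 := by
      rw [inner_sub_right, inner_smul_right, inner_smul_right, real_inner_self_eq_norm_sq,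
        real_inner_comm]
      field_simp
      linarith
    have h2 := h _ h1
    rw [inner_sub_right, inner_smul_right, inner_smul_right, real_inner_self_eq_norm_sq] at h2
    field_simp at h2
    linarith
  have h3 := inner_eq_norm_mul_iff_real.1 key
  rw [inv_smul_eq_iff₀ hg'.ne', smul_comm, eq_comm, inv_smul_eq_iff₀ ha'.ne']
  exact h3.symm

/-- The Weinstein–Aronszajn identity for linear maps. -/
theorem LinearMap.det_one_sub_comp_comm {U W : Type*} [AddCommGroup U] [Module ℝ U]
    [FiniteDimensional ℝ U] [AddCommGroup W] [Module ℝ W] [FiniteDimensional ℝ W]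
    (A : U →ₗ[ℝ] W) (B : W →ₗ[ℝ] U) :
    LinearMap.det (LinearMap.id - A ∘ₗ B) = LinearMap.det (LinearMap.id - B ∘ₗ A) := by
  classical
  have b := Module.finBasis ℝ U
  have c := Module.finBasis ℝ W
  rw [← LinearMap.det_toMatrix c, ← LinearMap.det_toMatrix b, map_sub, map_sub,
    LinearMap.toMatrix_id, LinearMap.toMatrix_id, LinearMap.toMatrix_comp c b c,
    LinearMap.toMatrix_comp b c b, Matrix.det_one_sub_mul_comm]

/-- The inequality of arithmetic and geometric means for the eigenvalues of a positive semidefinite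
operator. -/
theorem LinearMap.IsSymmetric.det_le_trace_div_pow {V : Type*} [NormedAddCommGroup V]
    [InnerProductSpace ℝ V] [FiniteDimensional ℝ V] {n : ℕ} (hn : Module.finrank ℝ V = n)
    (hn0 : 0 < n) {T : V →ₗ[ℝ] V} (hT : T.IsSymmetric) (hpos : ∀ v, 0 ≤ inner ℝ v (T v)) :
    0 ≤ LinearMap.det T ∧ 0 ≤ LinearMap.trace ℝ V T / n ∧
      LinearMap.det T ≤ (LinearMap.trace ℝ V T / n) ^ n := by
  have hev : ∀ i, 0 ≤ hT.eigenvalues hn i := fun i =>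
    eigenvalue_nonneg_of_nonneg (hT.hasEigenvalue_eigenvalues hn i) fun x => by
      simpa using hpos x
  have hn' : (0 : ℝ) < n := by exact_mod_cast hn0
  rw [hT.det_eq_prod_eigenvalues hn, hT.trace_eq_sum_eigenvalues hn]
  simp only [RCLike.ofReal_real_eq_id, id_eq]
  have hprod : 0 ≤ ∏ i, hT.eigenvalues hn i := Finset.prod_nonneg fun i _ => hev i
  refine ⟨hprod, div_nonneg (Finset.sum_nonneg fun i _ => hev i) hn'.le, ?_⟩
  have h := Real.geom_mean_le_arith_mean Finset.univ (fun _ => (1 : ℝ)) (hT.eigenvalues hn)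
    (fun _ _ => zero_le_one) (by simpa using hn') (fun i _ => hev i)
  simp only [Real.rpow_one, Finset.sum_const, Finset.card_univ, Fintype.card_fin, nsmul_eq_mul,
    mul_one, one_mul] at h
  calc ∏ i, hT.eigenvalues hn i = ((∏ i, hT.eigenvalues hn i) ^ ((n : ℝ)⁻¹)) ^ n :=
        (Real.rpow_inv_natCast_pow hprod hn0.ne').symm
    _ ≤ _ := pow_le_pow_left₀ (Real.rpow_nonneg hprod _) h n

/-! ### Defining functions and the unit normal -/

section InnerTube

variable {N : ℕ} {Ω : Set (EuclideanSpace ℝ (Fin N))} {x : EuclideanSpace ℝ (Fin N)}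
  {φ ψ : EuclideanSpace ℝ (Fin N) → ℝ}

theorem ContDiffAt.gradient {V : Type*} [NormedAddCommGroup V] [InnerProductSpace ℝ V]
    [CompleteSpace V] {f : V → ℝ} {x : V} (hf : ContDiffAt ℝ 2 f x) :
    ContDiffAt ℝ 1 (∇ f) x :=
  (InnerProductSpace.toDual ℝ V).symm.contDiff.contDiffAt.comp x
    (hf.fderiv_right (m := 1) (by norm_num))

theorem HasFDerivAt.hasDerivAt_add_smul {V : Type*} [NormedAddCommGroup V] [NormedSpace ℝ V]
    {f : V → ℝ} {f' : V →L[ℝ] ℝ} {x : V} (hf : HasFDerivAt f f' x) (v : V) :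
    HasDerivAt (fun s : ℝ => f (x + s • v)) (f' v) 0 := by
  have h1 : HasDerivAt (fun s : ℝ => x + s • v) v 0 := by
    simpa using ((hasDerivAt_id (0 : ℝ)).smul_const v).const_add x
  refine HasFDerivAt.comp_hasDerivAt (0 : ℝ) ?_ h1
  simpa using hf

/-- If a function vanishes at `x` and decreases in the direction `v`, it is negative at the points
`x + s v` for small `s > 0`. -/
theorem HasFDerivAt.eventually_lt_zero_of_apply_neg {V : Type*} [NormedAddCommGroup V]
    [NormedSpace ℝ V] {f : V → ℝ} {f' : V →L[ℝ] ℝ} {x : V} (hf : HasFDerivAt f f' x)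
    (hx : f x = 0) {v : V} (hv : f' v < 0) : ∀ᶠ s in 𝓝[>] (0 : ℝ), f (x + s • v) < 0 := by
  have hd := hf.hasDerivAt_add_smul v
  have h2 := (hasDerivAt_iff_tendsto_slope.1 hd).eventually (gt_mem_nhds hv)
  have h3 := h2.filter_mono (nhdsWithin_mono (0 : ℝ) fun s (hs : 0 < s) => ne_of_gt hs)
  filter_upwards [h3, self_mem_nhdsWithin] with s hs (hs0 : 0 < s)
  rw [slope_def_field] at hs
  simp only [zero_smul, add_zero, hx, sub_zero] at hs
  exact (div_neg_iff.1 hs).resolve_left (fun h => absurd h.2 (not_lt.2 hs0.le)) |>.1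

namespace IsC2DefiningFunctionAt

theorem differentiableAt (h : IsC2DefiningFunctionAt Ω x φ) : DifferentiableAt ℝ φ x :=
  h.contDiffAt.differentiableAt (by norm_num)

theorem norm_gradient_pos (h : IsC2DefiningFunctionAt Ω x φ) : 0 < ‖∇ φ x‖ :=
  norm_pos_iff.2 h.gradient_ne_zero

theorem norm_unitNormal (h : IsC2DefiningFunctionAt Ω x φ) : ‖unitNormal φ x‖ = 1 := by
  rw [unitNormal, norm_smul, norm_inv, norm_norm, inv_mul_cancel₀ h.norm_gradient_pos.ne']

theorem norm_smul_unitNormal (h : IsC2DefiningFunctionAt Ω x φ) :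
    ‖∇ φ x‖ • unitNormal φ x = ∇ φ x := by
  rw [unitNormal, smul_inv_smul₀ h.norm_gradient_pos.ne']

theorem contDiffAt_unitNormal (h : IsC2DefiningFunctionAt Ω x φ) :
    ContDiffAt ℝ 1 (unitNormal φ) x :=
  ((h.contDiffAt.gradient.norm ℝ h.gradient_ne_zero).inv h.norm_gradient_pos.ne').smul
    h.contDiffAt.gradient

theorem eventually_eq_zero (h : IsC2DefiningFunctionAt Ω x φ) (hΩ : IsOpen Ω) :
    ∀ᶠ y in 𝓝 x, y ∈ frontier Ω → φ y = 0 := by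
  have hc : ∀ᶠ y in 𝓝 x, ContinuousAt φ y :=
    (h.contDiffAt.eventually (by simp)).mono fun y hy => hy.continuousAt
  filter_upwards [h.mem_iff.eventually_nhds, hc] with y hy hcy hyf
  rw [hΩ.frontier_eq] at hyf
  refine le_antisymm ?_ (not_lt.1 fun hlt => hyf.2 (hy.self_of_nhds.2 hlt))
  by_contra! hpos
  obtain ⟨z, hz1, hz2, hz3⟩ := ((mem_closure_iff_frequently.1 hyf.1).and_eventually
    (hy.and (hcy.eventually (lt_mem_nhds hpos)))).exists
  exact absurd (hz2.1 hz1) (not_lt.2 hz3.le)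

/-- The points of `Ω` accumulate at a zero of the defining function in the direction opposite to
the gradient, so the zeros near `x` are boundary points. -/
theorem eventually_mem_frontier (h : IsC2DefiningFunctionAt Ω x φ) (hΩ : IsOpen Ω) :
    ∀ᶠ y in 𝓝 x, φ y = 0 → y ∈ frontier Ω := by
  have hg : ∀ᶠ y in 𝓝 x, ∇ φ y ≠ 0 :=
    h.contDiffAt.gradient.continuousAt.eventually_ne h.gradient_ne_zero
  filter_upwards [h.mem_iff.eventually_nhds, h.contDiffAt.eventually (by simp), hg]
    with y hy hcy hgy hy0
  rw [hΩ.frontier_eq]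
  refine ⟨?_, fun hyΩ => absurd (hy.self_of_nhds.1 hyΩ) (by simp [hy0])⟩
  have hd : DifferentiableAt ℝ φ y := hcy.differentiableAt (by norm_num)
  have hneg : fderiv ℝ φ y (-∇ φ y) < 0 := by
    rw [← inner_gradient_left, inner_neg_right, real_inner_self_eq_norm_sq]
    have := norm_pos_iff.2 hgy
    nlinarith
  have h1 := hd.hasFDerivAt.eventually_lt_zero_of_apply_neg hy0 hneg
  have ht : Filter.Tendsto (fun s : ℝ => y + s • (-∇ φ y)) (𝓝[>] 0) (𝓝 y) := by
    have : Continuous fun s : ℝ => y + s • (-∇ φ y) := by fun_prop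
    simpa using this.continuousWithinAt.tendsto (s := Set.Ioi 0) (x := 0)
  refine mem_closure_of_tendsto ht ?_
  filter_upwards [h1, ht.eventually hy] with s hs1 hs2
  exact hs2.2 hs1

/-- A defining function near `x` is also one near the boundary points close to `x`. -/
theorem eventually (h : IsC2DefiningFunctionAt Ω x φ) (hΩ : IsOpen Ω) :
    ∀ᶠ y in 𝓝 x, y ∈ frontier Ω → IsC2DefiningFunctionAt Ω y φ := by
  have hg : ∀ᶠ y in 𝓝 x, ∇ φ y ≠ 0 :=
    h.contDiffAt.gradient.continuousAt.eventually_ne h.gradient_ne_zero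
  filter_upwards [h.mem_iff.eventually_nhds, h.contDiffAt.eventually (by simp), hg,
    h.eventually_eq_zero hΩ] with y hy hcy hgy hy0 hyf
  exact ⟨hcy, hy0 hyf, hgy, hy⟩

/-- If all directions `v` with `⟪a, v⟫ < 0` point into `Ω` at `x`, then the exterior unit normal
at `x` is `a / |a|`. -/
theorem unitNormal_eq_of_forall_inner_neg (h : IsC2DefiningFunctionAt Ω x φ)
    {a : EuclideanSpace ℝ (Fin N)} (ha : a ≠ 0)
    (hin : ∀ v, inner ℝ a v < 0 → ∀ᶠ s in 𝓝[>] (0 : ℝ), x + s • v ∈ Ω) :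
    unitNormal φ x = ‖a‖⁻¹ • a := by
  refine inv_norm_smul_eq_of_halfspace_subset ha h.gradient_ne_zero fun v hv => ?_
  rw [inner_gradient_left]
  by_contra! hpos
  have hd := h.differentiableAt.hasFDerivAt.neg.eventually_lt_zero_of_apply_neg
    (by simp [h.eq_zero]) (v := v) (by simpa using hpos)
  have ht : Filter.Tendsto (fun s : ℝ => x + s • v) (𝓝[>] 0) (𝓝 x) := by
    have : Continuous fun s : ℝ => x + s • v := by fun_prop
    simpa using this.continuousWithinAt.tendsto (s := Set.Ioi 0) (x := 0)
  obtain ⟨s, hs1, hs2, hs3⟩ := (hd.and ((hin v hv).and (ht.eventually h.mem_iff))).exists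
  have := hs3.1 hs2
  simp only [Pi.neg_apply] at hs1
  linarith

theorem unitNormal_eq (h : IsC2DefiningFunctionAt Ω x φ) (h' : IsC2DefiningFunctionAt Ω x ψ) :
    unitNormal φ x = unitNormal ψ x := by
  refine h.unitNormal_eq_of_forall_inner_neg h'.gradient_ne_zero fun v hv => ?_
  rw [inner_gradient_left] at hv
  have hd := h'.differentiableAt.hasFDerivAt.eventually_lt_zero_of_apply_neg h'.eq_zero hv
  have ht : Filter.Tendsto (fun s : ℝ => x + s • v) (𝓝[>] 0) (𝓝 x) := by
    have : Continuous fun s : ℝ => x + s • v := by fun_prop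
    simpa using this.continuousWithinAt.tendsto (s := Set.Ioi 0) (x := 0)
  filter_upwards [hd, ht.eventually h'.mem_iff] with s hs1 hs2
  exact hs2.2 hs1

/-- If a ball contained in `Ω` touches the boundary at `x`, its centre lies on the interior normal
at `x`. -/
theorem unitNormal_eq_of_ball_subset (h : IsC2DefiningFunctionAt Ω x φ)
    {c : EuclideanSpace ℝ (Fin N)} (hc : c ≠ x) (hball : ball c (dist x c) ⊆ Ω) :
    dist x c • unitNormal φ x = x - c := by
  have ha : x - c ≠ 0 := sub_ne_zero.2 hc.symm
  rw [h.unitNormal_eq_of_forall_inner_neg ha, dist_eq_norm, smul_inv_smul₀ (norm_ne_zero_iff.2 ha)]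
  intro v hv
  have hd : HasFDerivAt (fun y => ‖y - c‖ ^ 2 - ‖x - c‖ ^ 2) (2 • innerSL ℝ (x - c)) x := by
    have := (((hasFDerivAt_id (𝕜 := ℝ) x).sub_const c).norm_sq).sub_const (‖x - c‖ ^ 2)
    simpa using this
  have h1 := hd.eventually_lt_zero_of_apply_neg (by simp) (v := v)
    (by simp [inner_sub_left] at hv ⊢; linarith)
  filter_upwards [h1] with s hs
  apply hball
  rw [mem_ball, dist_eq_norm, dist_eq_norm]
  exact lt_of_pow_lt_pow_left₀ 2 (norm_nonneg _) (by linarith)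

/-- Against tangent vectors, the derivative of `∇φ / |∇φ|` is that of `∇φ` divided by `|∇φ|`: the
derivative of the scalar factor only contributes a normal component. -/
theorem inner_fderiv_unitNormal (h : IsC2DefiningFunctionAt Ω x φ)
    (u : EuclideanSpace ℝ (Fin N)) {v : EuclideanSpace ℝ (Fin N)} (hv : inner ℝ (∇ φ x) v = 0) :
    inner ℝ (fderiv ℝ (unitNormal φ) x u) v = ‖∇ φ x‖⁻¹ * inner ℝ (fderiv ℝ (∇ φ) x u) v := by
  have hg : DifferentiableAt ℝ (∇ φ) x := h.contDiffAt.gradient.differentiableAt (by norm_num)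
  have hn : DifferentiableAt ℝ (fun y => ‖∇ φ y‖⁻¹) x :=
    (hg.norm ℝ h.gradient_ne_zero).inv h.norm_gradient_pos.ne'
  have : fderiv ℝ (unitNormal φ) x = _ := fderiv_smul hn hg
  rw [this]
  simp [inner_add_left, inner_smul_left, hv]

theorem inner_fderiv_gradient (h : IsC2DefiningFunctionAt Ω x φ)
    (u v : EuclideanSpace ℝ (Fin N)) :
    inner ℝ (fderiv ℝ (∇ φ) x u) v = fderiv ℝ (fderiv ℝ φ) x u v := by
  have hd : DifferentiableAt ℝ (fderiv ℝ φ) x :=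
    (h.contDiffAt.fderiv_right (m := 1) (by norm_num)).differentiableAt (by norm_num)
  have hg : DifferentiableAt ℝ (∇ φ) x := h.contDiffAt.gradient.differentiableAt (by norm_num)
  have h1 := (hd.hasFDerivAt.clm_apply (hasFDerivAt_const v x)).fderiv
  have h2 := (hg.hasFDerivAt.inner ℝ (hasFDerivAt_const v x)).fderiv
  simp only [← inner_gradient_left] at h1
  rw [h1] at h2
  simpa using (congrArg (fun L => L u) h2).symm

theorem isSymmetric_shapeOperator (h : IsC2DefiningFunctionAt Ω x φ) :
    (shapeOperator φ x).IsSymmetric := by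
  have hs : ∀ u v : tangentHyperplane φ x, inner ℝ (shapeOperator φ x u) v =
      ‖∇ φ x‖⁻¹ * fderiv ℝ (fderiv ℝ φ) x u v := by
    intro u v
    rw [← h.inner_fderiv_gradient, ← h.inner_fderiv_unitNormal _
      (Submodule.mem_orthogonal_singleton_iff_inner_right.1 v.2)]
    exact Submodule.inner_orthogonalProjectionOnto_eq_of_mem_right v _
  intro u v
  rw [hs, real_inner_comm, hs, (h.contDiffAt.isSymmSndFDerivAt (by simp)).eq]

end IsC2DefiningFunctionAt

/-- A local graph representation of the boundary yields the defining function
`y ↦ ⟪e, y⟫ - f(y')`, where `y'` is the projection of `y` to the hyperplane `e^⊥`. -/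
theorem HasC2Boundary.exists_isC2DefiningFunctionAt (h : HasC2Boundary Ω) (hΩ : IsOpen Ω)
    (hx : x ∈ frontier Ω) : ∃ φ, IsC2DefiningFunctionAt Ω x φ := by
  obtain ⟨e, he, f, hf, hfe⟩ := h x hx
  have hc : ContDiffAt ℝ 2
      (fun y => inner ℝ e y - f ((ℝ ∙ e)ᗮ.orthogonalProjectionOnto y)) x := by
    have hp : ContDiffAt ℝ 2 (fun y => (ℝ ∙ e)ᗮ.orthogonalProjectionOnto y) x :=
      ((ℝ ∙ e)ᗮ.orthogonalProjectionOnto).contDiff.contDiffAt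
    exact (contDiffAt_const.inner ℝ contDiffAt_id).sub
      (ContDiffAt.comp x (g := f) hf hp)
  have hm : ∀ᶠ y in 𝓝 x, y ∈ Ω ↔
      inner ℝ e y - f ((ℝ ∙ e)ᗮ.orthogonalProjectionOnto y) < 0 := by
    filter_upwards [hfe] with y hy
    rw [hy, sub_neg]
  refine ⟨_, hc, ?_, ?_, hm⟩
  · rw [hΩ.frontier_eq] at hx
    refine le_antisymm ?_ (not_lt.1 fun hlt => hx.2 (hm.self_of_nhds.2 hlt))
    by_contra! hpos
    obtain ⟨z, hz1, hz2, hz3⟩ := ((mem_closure_iff_frequently.1 hx.1).and_eventually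
      (hm.and (hc.continuousAt.eventually (lt_mem_nhds hpos)))).exists
    exact absurd (hz2.1 hz1) (not_lt.2 hz3.le)
  · intro h0
    have hd := hc.differentiableAt (by norm_num)
    have h1 := (inner_gradient_left (𝕜 := ℝ) (f := fun y => inner ℝ e y -
      f ((ℝ ∙ e)ᗮ.orthogonalProjectionOnto y)) (x := x) (y := e)).symm
    rw [h0, inner_zero_left] at h1
    -- along the direction `e`, the function grows with slope one
    have h2 := hd.hasFDerivAt.hasDerivAt_add_smul e
    rw [h1] at h2
    have hpe : (ℝ ∙ e)ᗮ.orthogonalProjectionOnto e = 0 := by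
      rw [Submodule.orthogonalProjectionOnto_eq_zero_iff, Submodule.orthogonal_orthogonal]
      exact Submodule.mem_span_singleton_self e
    have h4 : HasDerivAt (fun s : ℝ => inner ℝ e (x + s • e) -
        f ((ℝ ∙ e)ᗮ.orthogonalProjectionOnto (x + s • e))) (1 : ℝ) 0 := by
      simp only [map_add, map_smul, hpe, smul_zero, add_zero, inner_add_right, inner_smul_right,
        real_inner_self_eq_norm_sq, he, one_pow, mul_one]
      exact ((hasDerivAt_id (0 : ℝ)).const_add _).sub_const _
    exact one_ne_zero (h4.unique h2)

/-! ### Graph charts over the tangent hyperplane -/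

/-- The orthogonal projection of `w` to the affine hyperplane through `x` with unit normal `e`. -/
def hyperplaneProj {V : Type*} [NormedAddCommGroup V] [InnerProductSpace ℝ V] (e x w : V) : V :=
  w - inner ℝ e (w - x) • e

section HyperplaneProj

variable {V : Type*} [NormedAddCommGroup V] [InnerProductSpace ℝ V]

theorem hyperplaneProj_self (e x : V) : hyperplaneProj e x x = x := by
  simp [hyperplaneProj]

theorem hyperplaneProj_add_smul {e : V} (he : ‖e‖ = 1) (x w : V) (s : ℝ) :
    hyperplaneProj e x (w + s • e) = hyperplaneProj e x w := by
  simp only [hyperplaneProj, add_sub_right_comm w _ x, inner_add_right, inner_smul_right,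
    real_inner_self_eq_norm_sq, he]
  module

theorem inner_hyperplaneProj_sub {e : V} (he : ‖e‖ = 1) (x w : V) :
    inner ℝ e (hyperplaneProj e x w - x) = 0 := by
  rw [hyperplaneProj, sub_right_comm, inner_sub_right, inner_smul_right,
    real_inner_self_eq_norm_sq, he]
  ring

theorem hyperplaneProj_hyperplaneProj {e : V} (he : ‖e‖ = 1) (x w : V) :
    hyperplaneProj e x (hyperplaneProj e x w) = hyperplaneProj e x w := by
  rw [hyperplaneProj, inner_hyperplaneProj_sub he, zero_smul, sub_zero]

theorem hyperplaneProj_add_inner_smul (e x w : V) :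
    hyperplaneProj e x w + inner ℝ e (w - x) • e = w := sub_add_cancel _ _

theorem hasFDerivAt_hyperplaneProj (e x w : V) :
    HasFDerivAt (hyperplaneProj e x)
      (ContinuousLinearMap.id ℝ V - (innerSL ℝ e).smulRight e) w := by
  have h : HasFDerivAt (fun w => inner ℝ e (w - x)) (innerSL ℝ e) w :=
    (innerSL ℝ e).hasFDerivAt.comp w ((hasFDerivAt_id w).sub_const x)
  exact (hasFDerivAt_id w).sub (h.smul_const e)

theorem contDiff_hyperplaneProj (e x : V) {n : WithTop ℕ∞} :
    ContDiff ℝ n (hyperplaneProj e x) :=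
  contDiff_id.sub ((contDiff_const.inner ℝ (contDiff_id.sub contDiff_const)).smul contDiff_const)

theorem continuous_hyperplaneProj (e x : V) : Continuous (hyperplaneProj e x) :=
  (contDiff_hyperplaneProj e x (n := 0)).continuous

theorem lipschitzWith_hyperplaneProj {e : V} (he : ‖e‖ = 1) (x : V) :
    LipschitzWith 1 (hyperplaneProj e x) := by
  refine LipschitzWith.of_dist_le_mul fun v w => ?_
  have h : hyperplaneProj e x v - hyperplaneProj e x w = (v - w) - inner ℝ e (v - w) • e := by
    simp only [hyperplaneProj, inner_sub_right]
    module
  rw [NNReal.coe_one, one_mul, dist_eq_norm, dist_eq_norm, h]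
  refine le_of_sq_le_sq ?_ (norm_nonneg _)
  rw [norm_sub_sq_real, inner_smul_right, norm_smul, he, real_inner_comm, Real.norm_eq_abs,
    mul_one, sq_abs]
  nlinarith [sq_nonneg (inner ℝ e (v - w))]

end HyperplaneProj

namespace IsC2DefiningFunctionAt

/-- Near a boundary point `x`, the boundary is the image of the tangent hyperplane at `x` under a
local diffeomorphism `Θ` which moves points in the normal direction only and is tangent to the
identity at `x`. It is the local inverse of the map whose tangential part is the projection and
whose normal coordinate is `φ / |∇φ(x)|`. -/
theorem exists_chart (h : IsC2DefiningFunctionAt Ω x φ) :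
    ∃ Θ : EuclideanSpace ℝ (Fin N) → EuclideanSpace ℝ (Fin N),
      ContDiffAt ℝ 1 Θ x ∧ HasFDerivAt Θ (ContinuousLinearMap.id ℝ _) x ∧ Θ x = x ∧
      (∀ᶠ w in 𝓝 x, hyperplaneProj (unitNormal φ x) x (Θ w) =
        hyperplaneProj (unitNormal φ x) x w) ∧
      (∀ᶠ w in 𝓝 x, inner ℝ (unitNormal φ x) (w - x) = 0 → φ (Θ w) = 0) ∧
      ∀ᶠ y in 𝓝 x, φ y = 0 → Θ (hyperplaneProj (unitNormal φ x) x y) = y := by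
  set e := unitNormal φ x with he
  have he1 : ‖e‖ = 1 := h.norm_unitNormal
  have hg := h.norm_gradient_pos
  set Ψ : EuclideanSpace ℝ (Fin N) → EuclideanSpace ℝ (Fin N) :=
    fun y => hyperplaneProj e x y + (‖∇ φ x‖⁻¹ * φ y) • e with hΨ
  have hΨx : Ψ x = x := by simp [hΨ, hyperplaneProj_self, h.eq_zero]
  have hΨc : ContDiffAt ℝ 1 Ψ x :=
    (contDiff_hyperplaneProj e x).contDiffAt.add
      ((contDiffAt_const.mul (h.contDiffAt.of_le (by norm_num))).smul contDiffAt_const)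
  have hΨd : HasFDerivAt Ψ
      ((ContinuousLinearEquiv.refl ℝ (EuclideanSpace ℝ (Fin N)) :
        EuclideanSpace ℝ (Fin N) →L[ℝ] EuclideanSpace ℝ (Fin N))) x := by
    have h1 := (hasFDerivAt_hyperplaneProj e x x).add
      ((h.differentiableAt.hasFDerivAt.const_mul ‖∇ φ x‖⁻¹).smul_const e)
    refine h1.congr_fderiv ?_
    ext1 v
    have : inner ℝ e v = ‖∇ φ x‖⁻¹ * inner ℝ (∇ φ x) v := by
      rw [he, unitNormal, real_inner_smul_left]
    simp [this]
  have hΨval : ∀ y, Ψ y = hyperplaneProj e x y + (‖∇ φ x‖⁻¹ * φ y) • e := fun _ => rfl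
  have hs := hΨc.hasStrictFDerivAt' hΨd one_ne_zero
  have hr := hs.eventually_right_inverse
  have hl := hs.eventually_left_inverse
  rw [hΨx] at hr
  have hproj : ∀ y, hyperplaneProj e x (Ψ y) = hyperplaneProj e x y := fun y => by
    rw [hΨ, hyperplaneProj_add_smul he1, hyperplaneProj_hyperplaneProj he1]
  refine ⟨hs.localInverse Ψ _ x, ?_, ?_, ?_, ?_, ?_, ?_⟩
  · have := hΨc.to_localInverse hΨd one_ne_zero
    rw [hΨx] at this
    exact this
  · have := hs.to_localInverse.hasFDerivAt
    rw [hΨx] at this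
    exact this
  · have := hs.localInverse_apply_image
    rwa [hΨx] at this
  · filter_upwards [hr] with w hw
    rw [← hproj, hw]
  · filter_upwards [hr] with w hw hw0
    rw [← hw] at hw0
    simp only [hΨval, add_sub_right_comm, inner_add_right, inner_hyperplaneProj_sub he1,
      inner_smul_right, real_inner_self_eq_norm_sq, he1] at hw0
    simpa [hg.ne'] using hw0
  · filter_upwards [hl] with y hy hy0
    conv_rhs => rw [← hy]
    simp [hΨ, hy0]

/-- The tangential derivatives of the unit normal do not depend on the defining function: the unit
normals agree on the boundary, which contains curves with every tangential direction. -/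
theorem fderiv_unitNormal_apply_eq (h : IsC2DefiningFunctionAt Ω x φ)
    (h' : IsC2DefiningFunctionAt Ω x ψ) (hΩ : IsOpen Ω) {v : EuclideanSpace ℝ (Fin N)}
    (hv : inner ℝ (unitNormal φ x) v = 0) :
    fderiv ℝ (unitNormal φ) x v = fderiv ℝ (unitNormal ψ) x v := by
  obtain ⟨Θ, hΘc, hΘd, hΘx, -, hΘ0, -⟩ := h.exists_chart
  have hcurve : HasDerivAt (fun s : ℝ => Θ (x + s • v)) v 0 := by
    have h1 : HasDerivAt (fun s : ℝ => x + s • v) v 0 := by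
      simpa using ((hasDerivAt_id (0 : ℝ)).smul_const v).const_add x
    have h2 : HasFDerivAt Θ (ContinuousLinearMap.id ℝ _) (x + (0 : ℝ) • v) := by simpa using hΘd
    exact h2.comp_hasDerivAt (0 : ℝ) h1
  have hder : ∀ {χ : EuclideanSpace ℝ (Fin N) → ℝ}, IsC2DefiningFunctionAt Ω x χ →
      HasDerivAt (fun s : ℝ => unitNormal χ (Θ (x + s • v))) (fderiv ℝ (unitNormal χ) x v) 0 := by
    intro χ hχ
    have h2 : HasFDerivAt (unitNormal χ) (fderiv ℝ (unitNormal χ) x) (Θ (x + (0 : ℝ) • v)) := by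
      simpa [hΘx] using (hχ.contDiffAt_unitNormal.differentiableAt one_ne_zero).hasFDerivAt
    exact h2.comp_hasDerivAt (0 : ℝ) hcurve
  have hline : Filter.Tendsto (fun s : ℝ => x + s • v) (𝓝 0) (𝓝 x) := by
    have : Continuous fun s : ℝ => x + s • v := by fun_prop
    simpa using this.tendsto 0
  have hcurve0 : Filter.Tendsto (fun s : ℝ => Θ (x + s • v)) (𝓝 0) (𝓝 x) := by
    simpa [hΘx] using hcurve.continuousAt.tendsto
  refine (hder h).unique ((hder h').congr_of_eventuallyEq ?_)
  filter_upwards [hline.eventually hΘ0, hcurve0.eventually (h.eventually_mem_frontier hΩ),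
    hcurve0.eventually (h.eventually hΩ), hcurve0.eventually (h'.eventually hΩ)]
    with s hs1 hs2 hs3 hs4
  have hmem := hs2 (hs1 (by simp [inner_smul_right, hv]))
  exact (hs3 hmem).unitNormal_eq (hs4 hmem)

end IsC2DefiningFunctionAt

/-! ### The shape operator and the mean curvature -/

/-- The shape operator extended to the whole space: the derivative of the unit normal, composed
with the orthogonal projection to the tangent hyperplane. -/
noncomputable def extendedShapeOperator (φ : EuclideanSpace ℝ (Fin N) → ℝ)
    (x : EuclideanSpace ℝ (Fin N)) : EuclideanSpace ℝ (Fin N) →L[ℝ] EuclideanSpace ℝ (Fin N) :=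
  fderiv ℝ (unitNormal φ) x ∘L
    (ContinuousLinearMap.id ℝ _ - (innerSL ℝ (unitNormal φ x)).smulRight (unitNormal φ x))

namespace IsC2DefiningFunctionAt

theorem inner_gradient_eq_zero_iff (h : IsC2DefiningFunctionAt Ω x φ)
    (v : EuclideanSpace ℝ (Fin N)) : inner ℝ (∇ φ x) v = 0 ↔ inner ℝ (unitNormal φ x) v = 0 := by
  rw [unitNormal, real_inner_smul_left]
  simp [h.norm_gradient_pos.ne']

theorem subtypeL_comp_orthogonalProjectionOnto (h : IsC2DefiningFunctionAt Ω x φ) :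
    (tangentHyperplane φ x).subtypeL ∘L (tangentHyperplane φ x).orthogonalProjectionOnto =
      ContinuousLinearMap.id ℝ _ - (innerSL ℝ (unitNormal φ x)).smulRight (unitNormal φ x) := by
  ext1 v
  have := Submodule.eq_starProjection_of_mem_orthogonal (K := tangentHyperplane φ x) (u := v)
    (v := v - inner ℝ (unitNormal φ x) v • unitNormal φ x) ?_ ?_
  · simpa using this
  · rw [Submodule.mem_orthogonal_singleton_iff_inner_right, h.inner_gradient_eq_zero_iff,
      inner_sub_right, inner_smul_right, real_inner_self_eq_norm_sq, h.norm_unitNormal]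
    ring
  · rw [sub_sub_cancel, Submodule.orthogonal_orthogonal, unitNormal]
    exact Submodule.smul_mem _ _ (Submodule.smul_mem _ _ (Submodule.mem_span_singleton_self _))

theorem extendedShapeOperator_eq_comp (h : IsC2DefiningFunctionAt Ω x φ) :
    (extendedShapeOperator φ x : EuclideanSpace ℝ (Fin N) →ₗ[ℝ] EuclideanSpace ℝ (Fin N)) =
      (fderiv ℝ (unitNormal φ) x ∘L (tangentHyperplane φ x).subtypeL).toLinearMap ∘ₗ
        (tangentHyperplane φ x).orthogonalProjectionOnto.toLinearMap := by
  rw [extendedShapeOperator, ← h.subtypeL_comp_orthogonalProjectionOnto]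
  rfl

/-- As `tr (P ∘ A) = tr (A ∘ P)`, the extension by zero in the normal direction keeps the trace. -/
theorem trace_shapeOperator (h : IsC2DefiningFunctionAt Ω x φ) :
    LinearMap.trace ℝ _ (shapeOperator φ x) =
      LinearMap.trace ℝ _ (extendedShapeOperator φ x).toLinearMap := by
  rw [h.extendedShapeOperator_eq_comp, LinearMap.trace_comp_comm']
  rfl

/-- As `det (1 - P ∘ A) = det (1 - A ∘ P)`, the Jacobian determinant of the normal map on the whole
space is the determinant of `1 - t S` on the tangent hyperplane. -/
theorem det_id_sub_smul_shapeOperator (h : IsC2DefiningFunctionAt Ω x φ) (t : ℝ) :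
    LinearMap.det (LinearMap.id - t • shapeOperator φ x) =
      (ContinuousLinearMap.id ℝ _ - t • extendedShapeOperator φ x).det := by
  have h1 := LinearMap.det_one_sub_comp_comm
    (t • (fderiv ℝ (unitNormal φ) x ∘L (tangentHyperplane φ x).subtypeL).toLinearMap)
    (tangentHyperplane φ x).orthogonalProjectionOnto.toLinearMap
  rw [LinearMap.smul_comp, ← h.extendedShapeOperator_eq_comp, LinearMap.comp_smul] at h1
  exact h1.symm

/-- The extended shape operator does not depend on the defining function. -/
theorem extendedShapeOperator_eq (h : IsC2DefiningFunctionAt Ω x φ)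
    (h' : IsC2DefiningFunctionAt Ω x ψ) (hΩ : IsOpen Ω) :
    extendedShapeOperator φ x = extendedShapeOperator ψ x := by
  ext1 v
  rw [extendedShapeOperator, extendedShapeOperator, ← h.unitNormal_eq h',
    ContinuousLinearMap.comp_apply, ContinuousLinearMap.comp_apply]
  refine h.fderiv_unitNormal_apply_eq h' hΩ ?_
  simp [inner_sub_right, inner_smul_right, h.norm_unitNormal]

theorem continuousAt_extendedShapeOperator (h : IsC2DefiningFunctionAt Ω x φ) :
    ContinuousAt (extendedShapeOperator φ) x := by
  have h1 : ContinuousAt (unitNormal φ) x := h.contDiffAt_unitNormal.continuousAt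
  have h2 : ContinuousAt (fderiv ℝ (unitNormal φ)) x :=
    (h.contDiffAt_unitNormal.fderiv_right (m := 0) (by norm_num)).continuousAt
  refine h2.clm_comp (continuousAt_const.sub ?_)
  have h3 : Continuous fun e : EuclideanSpace ℝ (Fin N) => (innerSL ℝ e).smulRight e := by
    have : Continuous fun e : EuclideanSpace ℝ (Fin N) =>
      ContinuousLinearMap.smulRightL ℝ (EuclideanSpace ℝ (Fin N)) (EuclideanSpace ℝ (Fin N))
        (innerSL ℝ e) e := by fun_prop
    exact this
  exact h3.continuousAt.comp h1

/-- The principal curvatures sum up to the trace of the shape operator of any defining function. -/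
theorem meanCurvature_eq (h : IsC2DefiningFunctionAt Ω x φ) (hΩ : IsOpen Ω) :
    meanCurvature Ω x =
      LinearMap.trace ℝ _ (extendedShapeOperator φ x).toLinearMap / ((N : ℝ) - 1) := by
  have hex : ∃ φ, IsC2DefiningFunctionAt Ω x φ := ⟨φ, h⟩
  have h' := hex.choose_spec
  rw [meanCurvature, principalCurvatures, dif_pos hex,
    ← Module.End.trace_eq_sum_roots_charpoly_of_splits h'.isSymmetric_shapeOperator.splits_charpoly,
    h'.trace_shapeOperator, h'.extendedShapeOperator_eq h hΩ]

end IsC2DefiningFunctionAt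

theorem HasC2Boundary.continuousOn_meanCurvature (hC2 : HasC2Boundary Ω) (hΩ : IsOpen Ω) :
    ContinuousOn (meanCurvature Ω) (frontier Ω) := by
  intro x hx
  obtain ⟨φ, h⟩ := hC2.exists_isC2DefiningFunctionAt hΩ hx
  have htr : Continuous fun A : EuclideanSpace ℝ (Fin N) →L[ℝ] EuclideanSpace ℝ (Fin N) =>
      LinearMap.trace ℝ _ A.toLinearMap :=
    (LinearMap.trace ℝ (EuclideanSpace ℝ (Fin N)) ∘ₗ
      ContinuousLinearMap.coeLM ℝ).continuous_of_finiteDimensional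
  have hc : ContinuousAt (fun y => LinearMap.trace ℝ _ (extendedShapeOperator φ y).toLinearMap /
      ((N : ℝ) - 1)) x :=
    (htr.continuousAt.comp h.continuousAt_extendedShapeOperator).div_const _
  refine hc.continuousWithinAt.congr_of_eventuallyEq ?_ (h.meanCurvature_eq hΩ)
  filter_upwards [nhdsWithin_le_nhds (h.eventually hΩ), self_mem_nhdsWithin] with y hy hyf
  exact (hy hyf).meanCurvature_eq hΩ

theorem HasC2Boundary.isGreatest_maxMeanCurvatureNeg (hC2 : HasC2Boundary Ω) (hΩ : IsOpen Ω)
    (hbdd : Bornology.IsBounded Ω) (hne : (frontier Ω).Nonempty) :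
    IsGreatest (meanCurvatureNeg Ω '' frontier Ω) (maxMeanCurvatureNeg Ω) := by
  have hcomp : IsCompact (frontier Ω) :=
    hbdd.isCompact_closure.of_isClosed_subset isClosed_frontier frontier_subset_closure
  have hcont : ContinuousOn (meanCurvatureNeg Ω) (frontier Ω) :=
    (hC2.continuousOn_meanCurvature hΩ).neg.sup continuousOn_const
  exact (hcomp.image_of_continuousOn hcont).isGreatest_sSup (hne.image _)

/-! ### Balls touching the boundary from inside -/

namespace IsC2DefiningFunctionAt

/-- If a ball of radius `t` contained in `Ω` touches the boundary at `x`, the principal curvatures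
at `x` are at most `1 / t`. This is the second derivative test along the parabolas
`s ↦ x + s v - a s² e` with `2 a t > |v|²`, which run inside the ball for small `s ≠ 0`. -/
theorem inner_fderiv_unitNormal_le_of_ball_subset (h : IsC2DefiningFunctionAt Ω x φ) {t : ℝ}
    (ht : 0 ≤ t) (hball : ball (x - t • unitNormal φ x) t ⊆ Ω) {v : EuclideanSpace ℝ (Fin N)}
    (hv : inner ℝ (unitNormal φ x) v = 0) :
    t * inner ℝ (fderiv ℝ (unitNormal φ) x v) v ≤ ‖v‖ ^ 2 := by
  rcases ht.eq_or_lt with rfl | ht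
  · simp
  set e := unitNormal φ x with he
  have he1 : ‖e‖ = 1 := h.norm_unitNormal
  have hgp := h.norm_gradient_pos
  have hge : inner ℝ (∇ φ x) e = ‖∇ φ x‖ := by
    conv_lhs => rw [← h.norm_smul_unitNormal, ← he]
    rw [real_inner_smul_left, real_inner_self_eq_norm_sq, he1]
    ring
  suffices hs : ∀ a, ‖v‖ ^ 2 / (2 * t) < a → inner ℝ (fderiv ℝ (unitNormal φ) x v) v ≤ 2 * a by
    have h1 : inner ℝ (fderiv ℝ (unitNormal φ) x v) v / 2 ≤ ‖v‖ ^ 2 / (2 * t) :=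
      le_of_forall_gt_imp_ge_of_dense fun a ha => by linarith [hs a ha]
    rw [div_le_div_iff₀ (by norm_num) (by positivity)] at h1
    linarith
  intro a ha
  rw [div_lt_iff₀ (by positivity)] at ha
  by_contra! hlt
  set c : ℝ → EuclideanSpace ℝ (Fin N) := fun s => x + s • v - (a * s ^ 2) • e with hc
  have hc0 : c 0 = x := by simp [hc]
  have hcd : ∀ s, HasDerivAt c (v - (a * (2 * s)) • e) s := by
    intro s
    have h1 : HasDerivAt (fun s : ℝ => x + s • v) v s := by
      simpa using ((hasDerivAt_id s).smul_const v).const_add x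
    have h2 : HasDerivAt (fun s : ℝ => (a * s ^ 2) • e) ((a * (2 * s)) • e) s := by
      simpa using (((hasDerivAt_id s).pow 2).const_mul a).smul_const e
    exact h1.sub h2
  have hct : Filter.Tendsto c (𝓝 0) (𝓝 x) := by
    simpa [hc0] using (hcd 0).continuousAt.tendsto
  have hderiv : ∀ᶠ s in 𝓝 (0 : ℝ),
      deriv (φ ∘ c) s = inner ℝ (∇ φ (c s)) (v - (a * (2 * s)) • e) := by
    filter_upwards [hct.eventually (h.contDiffAt.eventually (by simp))] with s hs
    rw [inner_gradient_left]
    exact ((hs.differentiableAt (by norm_num)).hasFDerivAt.comp_hasDerivAt s (hcd s)).deriv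
  have hderiv0 : deriv (φ ∘ c) 0 = 0 := by
    rw [hderiv.self_of_nhds, hc0]
    simpa using (h.inner_gradient_eq_zero_iff v).2 hv
  have hgrad : HasDerivAt (fun s => ∇ φ (c s)) (fderiv ℝ (∇ φ) x v) 0 := by
    have h1 : HasFDerivAt (∇ φ) (fderiv ℝ (∇ φ) x) (c 0) := by
      rw [hc0]
      exact (h.contDiffAt.gradient.differentiableAt (by norm_num)).hasFDerivAt
    have h2 := hcd 0
    simp only [mul_zero, zero_smul, sub_zero] at h2
    exact h1.comp_hasDerivAt (0 : ℝ) h2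
  have hlin : HasDerivAt (fun s : ℝ => v - (a * (2 * s)) • e) (-((a * 2) • e)) 0 := by
    simpa using ((((hasDerivAt_id (0 : ℝ)).const_mul 2).const_mul a).smul_const e).const_sub v
  have hsecond : deriv (deriv (φ ∘ c)) 0 =
      ‖∇ φ x‖ * (inner ℝ (fderiv ℝ (unitNormal φ) x v) v - 2 * a) := by
    rw [Filter.EventuallyEq.deriv_eq hderiv, (hgrad.inner ℝ hlin).deriv, hc0,
      h.inner_fderiv_unitNormal v ((h.inner_gradient_eq_zero_iff v).2 hv)]
    simp only [mul_zero, zero_smul, sub_zero, inner_neg_right, inner_smul_right, hge]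
    field_simp
    ring
  have hmin : IsLocalMin (φ ∘ c) 0 := by
    refine isLocalMin_of_deriv_deriv_pos ?_ hderiv0 ?_
    · rw [hsecond]
      exact mul_pos hgp (by linarith)
    · refine ContinuousAt.comp ?_ (hcd 0).continuousAt
      rw [hc0]
      exact h.contDiffAt.continuousAt
  have hsmall : ∀ᶠ s in 𝓝 (0 : ℝ), a ^ 2 * s ^ 2 < a * (2 * t) - ‖v‖ ^ 2 := by
    have : Continuous fun s : ℝ => a ^ 2 * s ^ 2 := by fun_prop
    exact this.continuousAt.eventually (gt_mem_nhds (by simpa using ha))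
  obtain ⟨s, ⟨hs1, hs2, hs3⟩, hs0⟩ := (((hmin.and (hsmall.and
    (hct.eventually h.mem_iff))).filter_mono nhdsWithin_le_nhds).and
    (self_mem_nhdsWithin (a := (0 : ℝ)) (s := {0}ᶜ))).exists
  have hs0 : 0 < s ^ 2 := sq_pos_of_ne_zero hs0
  have hneg : φ (c s) < 0 := by
    refine hs3.1 (hball ?_)
    rw [mem_ball, dist_eq_norm]
    refine lt_of_pow_lt_pow_left₀ 2 ht.le ?_
    have : c s - (x - t • e) = s • v + (t - a * s ^ 2) • e := by
      simp only [hc]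
      module
    rw [this, norm_add_sq_real, norm_smul, norm_smul, he1, real_inner_smul_left,
      real_inner_smul_right, real_inner_comm, hv, mul_pow, mul_pow, Real.norm_eq_abs,
      Real.norm_eq_abs, sq_abs, sq_abs]
    nlinarith
  simp only [Function.comp_apply, hc0, h.eq_zero] at hs1
  linarith

/-- The Jacobian determinant `∏ (1 - t kᵢ)` of the normal map is controlled by the mean curvature
as long as the ball of radius `t` touching the boundary at `x` is contained in `Ω`: then all the
factors are nonnegative, and the inequality of arithmetic and geometric means applies. -/
theorem det_id_sub_smul_extendedShapeOperator_bounds (h : IsC2DefiningFunctionAt Ω x φ) (hN : 2 ≤ N)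
    (hΩ : IsOpen Ω) {t : ℝ} (ht : 0 ≤ t) (hball : ball (x - t • unitNormal φ x) t ⊆ Ω) :
    0 ≤ (ContinuousLinearMap.id ℝ _ - t • extendedShapeOperator φ x).det ∧
      0 ≤ 1 - t * meanCurvature Ω x ∧
      (ContinuousLinearMap.id ℝ _ - t • extendedShapeOperator φ x).det ≤
        (1 - t * meanCurvature Ω x) ^ (N - 1) := by
  have hrank : Module.finrank ℝ (tangentHyperplane φ x) = N - 1 := by
    have h1 := Submodule.finrank_add_finrank_orthogonal (ℝ ∙ ∇ φ x)
    rw [finrank_span_singleton h.gradient_ne_zero, finrank_euclideanSpace_fin] at h1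
    change Module.finrank ℝ (ℝ ∙ ∇ φ x)ᗮ = N - 1
    omega
  have hN1 : ((N - 1 : ℕ) : ℝ) = (N : ℝ) - 1 := by
    rw [Nat.cast_sub (by omega), Nat.cast_one]
  have hN0 : (0 : ℝ) < (N : ℝ) - 1 := by
    have : (2 : ℝ) ≤ N := by exact_mod_cast hN
    linarith
  have hsymm : (LinearMap.id - t • shapeOperator φ x).IsSymmetric :=
    LinearMap.IsSymmetric.id.sub (h.isSymmetric_shapeOperator.smul (by simp))
  have hpos : ∀ v, 0 ≤ inner ℝ v 
      ((LinearMap.id - t • shapeOperator φ x : _ →ₗ[ℝ] tangentHyperplane φ x) v) := by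
    intro v
    have h1 : inner ℝ (shapeOperator φ x v) v = inner ℝ (fderiv ℝ (unitNormal φ) x v)
        (v : EuclideanSpace ℝ (Fin N)) :=
      Submodule.inner_orthogonalProjectionOnto_eq_of_mem_right v _
    have h2 := h.inner_fderiv_unitNormal_le_of_ball_subset ht hball
      ((h.inner_gradient_eq_zero_iff v).1
        (Submodule.mem_orthogonal_singleton_iff_inner_right.1 v.2))
    rw [LinearMap.sub_apply, LinearMap.smul_apply, LinearMap.id_apply, inner_sub_right,
      inner_smul_right, real_inner_self_eq_norm_sq, real_inner_comm, h1]
    simpa using h2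
  have h3 := hsymm.det_le_trace_div_pow hrank (by omega) hpos
  rw [h.det_id_sub_smul_shapeOperator] at h3
  rwa [map_sub, map_smul, LinearMap.trace_id, hrank, h.trace_shapeOperator, hN1, smul_eq_mul,
    sub_div, div_self hN0.ne', mul_div_assoc, ← h.meanCurvature_eq hΩ] at h3

end IsC2DefiningFunctionAt

/-! ### The normal map -/

/-- The normal map in the coordinates given by a chart `Θ` over the tangent hyperplane at `x`:
the point at height `s` above the hyperplane point `u` is sent to `y + s ν(y)`, where `y = Θ u`. -/
noncomputable def normalMap (φ : EuclideanSpace ℝ (Fin N) → ℝ)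
    (Θ : EuclideanSpace ℝ (Fin N) → EuclideanSpace ℝ (Fin N)) (x w : EuclideanSpace ℝ (Fin N)) :
    EuclideanSpace ℝ (Fin N) :=
  Θ (hyperplaneProj (unitNormal φ x) x w) + inner ℝ (unitNormal φ x) (w - x) •
    unitNormal φ (Θ (hyperplaneProj (unitNormal φ x) x w))

theorem ball_subset_of_le_infDist_compl {V : Type*} [PseudoMetricSpace V] {s : Set V} {c : V}
    {r : ℝ} (hr : r ≤ infDist c sᶜ) : ball c r ⊆ s :=
  (ball_subset_ball hr).trans (Set.disjoint_compl_right_iff_subset.1 disjoint_ball_infDist)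

namespace IsC2DefiningFunctionAt

variable {Θ : EuclideanSpace ℝ (Fin N) → EuclideanSpace ℝ (Fin N)}

theorem hyperplaneProj_sub_smul (h : IsC2DefiningFunctionAt Ω x φ) (y : EuclideanSpace ℝ (Fin N))
    (t : ℝ) : hyperplaneProj (unitNormal φ x) x (y - t • unitNormal φ x) =
      hyperplaneProj (unitNormal φ x) x y := by
  rw [sub_eq_add_neg, ← neg_smul, hyperplaneProj_add_smul h.norm_unitNormal]

theorem hyperplaneProj_base (h : IsC2DefiningFunctionAt Ω x φ) (t : ℝ) :
    hyperplaneProj (unitNormal φ x) x (x - t • unitNormal φ x) = x := by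
  rw [h.hyperplaneProj_sub_smul, hyperplaneProj_self]

theorem inner_unitNormal_base (h : IsC2DefiningFunctionAt Ω x φ) (t : ℝ) :
    inner ℝ (unitNormal φ x) (x - t • unitNormal φ x - x) = -t := by
  rw [sub_sub_cancel_left, inner_neg_right, inner_smul_right, real_inner_self_eq_norm_sq,
    h.norm_unitNormal]
  ring

theorem normalMap_base (h : IsC2DefiningFunctionAt Ω x φ) (hΘx : Θ x = x) (t : ℝ) :
    normalMap φ Θ x (x - t • unitNormal φ x) = x - t • unitNormal φ x := by
  rw [normalMap, h.hyperplaneProj_base, hΘx, h.inner_unitNormal_base, neg_smul, sub_eq_add_neg]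

theorem contDiffAt_normalMap (h : IsC2DefiningFunctionAt Ω x φ) (hΘ : ContDiffAt ℝ 1 Θ x)
    (hΘx : Θ x = x) (t : ℝ) :
    ContDiffAt ℝ 1 (normalMap φ Θ x) (x - t • unitNormal φ x) := by
  have h1 : ContDiffAt ℝ 1 (fun w => Θ (hyperplaneProj (unitNormal φ x) x w))
      (x - t • unitNormal φ x) := by
    refine ContDiffAt.comp (g := Θ) _ ?_ (contDiff_hyperplaneProj _ _).contDiffAt
    rwa [h.hyperplaneProj_base]
  have h2 : ContDiffAt ℝ 1 (fun w => unitNormal φ (Θ (hyperplaneProj (unitNormal φ x) x w)))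
      (x - t • unitNormal φ x) := by
    refine ContDiffAt.comp (g := unitNormal φ) _ ?_ h1
    rw [h.hyperplaneProj_base, hΘx]
    exact h.contDiffAt_unitNormal
  exact h1.add ((contDiffAt_const.inner ℝ (contDiffAt_id.sub contDiffAt_const)).smul h2)

/-- On the normal line at `x`, the derivative of the normal map involves the chart only through its
derivative at `x`, which is the identity. -/
theorem fderiv_normalMap_base (h : IsC2DefiningFunctionAt Ω x φ)
    (hΘ : HasFDerivAt Θ (ContinuousLinearMap.id ℝ _) x) (hΘx : Θ x = x) (t : ℝ) :
    fderiv ℝ (normalMap φ Θ x) (x - t • unitNormal φ x) =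
      ContinuousLinearMap.id ℝ _ - t • extendedShapeOperator φ x := by
  set e := unitNormal φ x with he
  have hp := hasFDerivAt_hyperplaneProj e x (x - t • e)
  have h1 : HasFDerivAt (fun w => Θ (hyperplaneProj e x w))
      (ContinuousLinearMap.id ℝ _ - (innerSL ℝ e).smulRight e) (x - t • e) := by
    have hΘ' : HasFDerivAt Θ (ContinuousLinearMap.id ℝ _) (hyperplaneProj e x (x - t • e)) := by
      rwa [h.hyperplaneProj_base]
    exact hΘ'.comp _ hp
  have h2 : HasFDerivAt (fun w => unitNormal φ (Θ (hyperplaneProj e x w)))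
      (extendedShapeOperator φ x) (x - t • e) := by
    have hν : HasFDerivAt (unitNormal φ) (fderiv ℝ (unitNormal φ) x)
        (Θ (hyperplaneProj e x (x - t • e))) := by
      rw [h.hyperplaneProj_base, hΘx]
      exact (h.contDiffAt_unitNormal.differentiableAt one_ne_zero).hasFDerivAt
    exact hν.comp (x - t • e) h1
  have h3 : HasFDerivAt (fun w => inner ℝ e (w - x)) (innerSL ℝ e) (x - t • e) :=
    (innerSL ℝ e).hasFDerivAt.comp (x - t • e) ((hasFDerivAt_id (x - t • e)).sub_const x)
  have h4 := (h1.add (h3.smul h2)).fderiv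
  refine Eq.trans h4 ?_
  rw [h.hyperplaneProj_base, hΘx, h.inner_unitNormal_base]
  ext1 v
  simp [← he]
  abel

/-- Near the interior normal at `x`, the Jacobian determinant of the normal map is almost bounded by
the value `(1 + η M)^(N - 1)` at all points `w` whose image is at least as far from the complement
of `Ω` as their height below the tangent hyperplane. At the points of the normal where this
closed condition fails, it also fails nearby; where it holds, the touching ball controls the
determinant. -/
theorem eventually_abs_det_fderiv_normalMap_le (h : IsC2DefiningFunctionAt Ω x φ) (hN : 2 ≤ N)
    (hΩ : IsOpen Ω) (hΘ : ContDiffAt ℝ 1 Θ x) (hΘd : HasFDerivAt Θ (ContinuousLinearMap.id ℝ _) x)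
    (hΘx : Θ x = x) {η M ε : ℝ} (hε : 0 < ε) (hM : 0 ≤ M) (hHM : -meanCurvature Ω x ≤ M) {t : ℝ}
    (ht : t ∈ Set.Icc 0 η) :
    ∀ᶠ w in 𝓝 (x - t • unitNormal φ x), DifferentiableAt ℝ (normalMap φ Θ x) w ∧
      (-inner ℝ (unitNormal φ x) (w - x) ≤ infDist (normalMap φ Θ x w) Ωᶜ →
        |(fderiv ℝ (normalMap φ Θ x) w).det| ≤ (1 + η * M) ^ (N - 1) + ε) := by
  have hc := h.contDiffAt_normalMap hΘ hΘx t
  have hd : ∀ᶠ w in 𝓝 (x - t • unitNormal φ x), DifferentiableAt ℝ (normalMap φ Θ x) w :=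
    (hc.eventually (by simp)).mono fun w hw => hw.differentiableAt one_ne_zero
  refine hd.and ?_
  by_cases hgood : t ≤ infDist (x - t • unitNormal φ x) Ωᶜ
  · obtain ⟨h0, h1, h2⟩ := h.det_id_sub_smul_extendedShapeOperator_bounds hN hΩ ht.1
      (ball_subset_of_le_infDist_compl hgood)
    have h3 : (1 - t * meanCurvature Ω x) ^ (N - 1) ≤ (1 + η * M) ^ (N - 1) := by
      refine pow_le_pow_left₀ h1 ?_ _
      nlinarith [mul_le_mul_of_nonneg_left hHM ht.1, mul_le_mul_of_nonneg_right ht.2 hM]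
    have h4 : ContinuousAt (fun w => |(fderiv ℝ (normalMap φ Θ x) w).det|)
        (x - t • unitNormal φ x) :=
      (ContinuousLinearMap.continuous_det.continuousAt.comp
        (hc.fderiv_right (m := 0) (by norm_num)).continuousAt).abs
    have h5 : |(fderiv ℝ (normalMap φ Θ x) (x - t • unitNormal φ x)).det| <
        (1 + η * M) ^ (N - 1) + ε := by
      rw [h.fderiv_normalMap_base hΘd hΘx, abs_of_nonneg h0]
      linarith
    filter_upwards [h4.eventually (gt_mem_nhds h5)] with w hw _ using hw.le
  · have h4 : ContinuousAt (fun w => infDist (normalMap φ Θ x w) Ωᶜ +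
        inner ℝ (unitNormal φ x) (w - x)) (x - t • unitNormal φ x) := by
      refine ((continuous_infDist_pt _).continuousAt.comp hc.continuousAt).add ?_
      fun_prop
    have h5 : infDist (normalMap φ Θ x (x - t • unitNormal φ x)) Ωᶜ +
        inner ℝ (unitNormal φ x) (x - t • unitNormal φ x - x) < 0 := by
      rw [h.normalMap_base hΘx, h.inner_unitNormal_base]
      linarith
    filter_upwards [h4.eventually (gt_mem_nhds h5)] with w hw hw'
    linarith

end IsC2DefiningFunctionAt

/-! ### Hausdorff measure of slices and of Lipschitz images -/

theorem LipschitzOnWith.euclideanHausdorffMeasure_image_le {X Y : Type*} [EMetricSpace X]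
    [MeasurableSpace X] [BorelSpace X] [EMetricSpace Y] [MeasurableSpace Y] [BorelSpace Y]
    {K : NNReal} {f : X → Y} {s : Set X} (hf : LipschitzOnWith K f s) (d : ℕ) :
    Measure.euclideanHausdorffMeasure d (f '' s) ≤
      (K : ENNReal) ^ d * Measure.euclideanHausdorffMeasure d s := by
  rw [Measure.euclideanHausdorffMeasure_def, Measure.euclideanHausdorffMeasure_def,
    Measure.smul_apply, Measure.smul_apply, ENNReal.smul_def, ENNReal.smul_def, smul_eq_mul,
    smul_eq_mul, mul_left_comm]
  gcongr
  simpa using hf.hausdorffMeasure_image_le (d := d) (by positivity)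

/-- If the slice of `s` at each height in `[a, b]` projects into `π(A)`, and the other slices are
empty, then the volume of `s` is at most `b - a` times the measure of `A`. -/
theorem volume_le_of_slices {s A : Set (EuclideanSpace ℝ (Fin N))} (hs : MeasurableSet s)
    {e : EuclideanSpace ℝ (Fin N)} (he : ‖e‖ = 1) {a b : ℝ}
    (hab : ∀ w ∈ s, inner ℝ e (w - x) ∈ Set.Icc a b)
    (hA : ∀ w ∈ s, ∃ y ∈ A, hyperplaneProj e x y = hyperplaneProj e x w) :
    volume s ≤ Measure.euclideanHausdorffMeasure (N - 1) A * ENNReal.ofReal (b - a) := by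
  have he0 : e ≠ 0 := norm_ne_zero_iff.1 (by simp [he])
  have h1 := EuclideanGeometry.euclideanHausdorffMeasure_eq_lintegral x he0 hs
  rw [InnerProductSpace.euclideanHausdorffMeasure_eq_volume, finrank_euclideanSpace_fin,
    ← ofReal_norm, he, ENNReal.ofReal_one, one_mul] at h1
  rw [h1, ← Real.volume_Icc, ← lintegral_indicator_const measurableSet_Icc]
  refine lintegral_mono fun c => ?_
  have hmem : ∀ w ∈ s ∩ AffineSubspace.mk' (c • e +ᵥ x) (ℝ ∙ e)ᗮ, inner ℝ e (w - x) = c := by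
    intro w hw
    have h2 := Submodule.mem_orthogonal_singleton_iff_inner_right.1
      (AffineSubspace.mem_mk'.1 hw.2)
    rw [vsub_eq_sub, vadd_eq_add, sub_add_eq_sub_sub_swap, inner_sub_right, inner_smul_right,
      real_inner_self_eq_norm_sq, he] at h2
    linarith
  by_cases hc : c ∈ Set.Icc a b
  · rw [Set.indicator_of_mem hc]
    have hlip : LipschitzWith 1 fun y => hyperplaneProj e x y + c • e :=
      LipschitzWith.of_dist_le_mul fun v w => by
        simpa using (lipschitzWith_hyperplaneProj he x).dist_le_mul v w
    refine (measure_mono (t := (fun y => hyperplaneProj e x y + c • e) '' A) ?_).trans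
      ((hlip.lipschitzOnWith (s := A)).euclideanHausdorffMeasure_image_le _ |>.trans (by simp))
    intro w hw
    obtain ⟨y, hy, hyw⟩ := hA w hw.1
    refine ⟨y, hy, ?_⟩
    simp only [hyw]
    rw [← hmem w hw, hyperplaneProj_add_inner_smul]
  · rw [Set.indicator_of_notMem hc, nonpos_iff_eq_zero]
    have : s ∩ AffineSubspace.mk' (c • e +ᵥ x) (ℝ ∙ e)ᗮ = ∅ := by
      refine Set.eq_empty_of_forall_notMem fun w hw => hc ?_
      rw [← hmem w hw]
      exact hab w hw.1
    rw [this, measure_empty]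

theorem ContinuousOn.measurableSet_inter_preimage {X Y : Type*} [TopologicalSpace X]
    [MeasurableSpace X] [BorelSpace X] [TopologicalSpace Y] [MeasurableSpace Y] [BorelSpace Y]
    {f : X → Y} {s : Set X} {t : Set Y} (hf : ContinuousOn f s) (hs : MeasurableSet s)
    (ht : MeasurableSet t) : MeasurableSet (s ∩ f ⁻¹' t) := by
  rw [← Subtype.image_preimage_coe]
  exact hs.subtype_image (hf.domRestrict.measurable ht)

/-- Bounded pieces of a hyperplane have finite measure. -/
theorem euclideanHausdorffMeasure_hyperplane_inter_ball_lt_top {e : EuclideanSpace ℝ (Fin N)}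
    (he : e ≠ 0) (x : EuclideanSpace ℝ (Fin N)) (r : ℝ) :
    Measure.euclideanHausdorffMeasure (N - 1) ({w | inner ℝ e (w - x) = 0} ∩ ball x r) < ⊤ := by
  have hrank : Module.finrank ℝ (ℝ ∙ e)ᗮ = N - 1 := by
    have h1 := Submodule.finrank_add_finrank_orthogonal (ℝ ∙ e)
    rw [finrank_span_singleton he, finrank_euclideanSpace_fin] at h1
    omega
  have hiso : Isometry fun u : (ℝ ∙ e)ᗮ => x + (u : EuclideanSpace ℝ (Fin N)) :=
    Isometry.of_dist_eq fun u v => by rw [dist_add_left, Subtype.dist_eq]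
  refine (measure_mono (t := (fun u : (ℝ ∙ e)ᗮ => x + (u : EuclideanSpace ℝ (Fin N))) ''
    ball 0 r) ?_).trans_lt ?_
  · rintro w ⟨hw, hwr⟩
    refine ⟨⟨w - x, Submodule.mem_orthogonal_singleton_iff_inner_right.2 hw⟩, ?_, by simp⟩
    rw [mem_ball_zero_iff]
    simpa [dist_eq_norm] using hwr
  · rw [hiso.euclideanHausdorffMeasure_image, ← hrank,
      InnerProductSpace.euclideanHausdorffMeasure_eq_volume]
    exact measure_ball_lt_top

/-! ### Inner tubes -/

/-- The points of `Ω` at distance at most `η` from the boundary for which some nearest boundary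
point belongs to `A`. -/
def innerTube (Ω : Set (EuclideanSpace ℝ (Fin N))) (η : ℝ) (A : Set (EuclideanSpace ℝ (Fin N))) :
    Set (EuclideanSpace ℝ (Fin N)) :=
  {z ∈ Ω | infDist z (frontier Ω) ≤ η ∧
    ∃ y ∈ A ∩ frontier Ω, dist y z = infDist z (frontier Ω)}

/-- A point of `Ω` is no closer to the complement than to the boundary, since a nearest point of the
complement can be chosen on the boundary. -/
theorem infDist_frontier_le_infDist_compl {z : EuclideanSpace ℝ (Fin N)} (hz : z ∈ Ω)
    (hne : Ω ≠ Set.univ) : infDist z (frontier Ω) ≤ infDist z Ωᶜ := by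
  obtain ⟨y, hy, hyz⟩ := exists_mem_frontier_infDist_compl_eq_dist hz hne
  rw [hyz]
  exact infDist_le_dist_of_mem hy

namespace IsC2DefiningFunctionAt

variable {Θ : EuclideanSpace ℝ (Fin N) → EuclideanSpace ℝ (Fin N)}

/-- By compactness, the determinant bound holds uniformly near the normal segment at `x`. -/
theorem exists_thickening_abs_det_fderiv_normalMap_le (h : IsC2DefiningFunctionAt Ω x φ)
    (hN : 2 ≤ N) (hΩ : IsOpen Ω) (hΘ : ContDiffAt ℝ 1 Θ x)
    (hΘd : HasFDerivAt Θ (ContinuousLinearMap.id ℝ _) x) (hΘx : Θ x = x) {η M ε : ℝ}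
    (hε : 0 < ε) (hM : 0 ≤ M) (hHM : -meanCurvature Ω x ≤ M) :
    ∃ δ > 0, ∀ w ∈ thickening δ ((fun t : ℝ => x - t • unitNormal φ x) '' Set.Icc 0 η),
      DifferentiableAt ℝ (normalMap φ Θ x) w ∧
      (-inner ℝ (unitNormal φ x) (w - x) ≤ infDist (normalMap φ Θ x w) Ωᶜ →
        |(fderiv ℝ (normalMap φ Θ x) w).det| ≤ (1 + η * M) ^ (N - 1) + ε) := by
  have hKc : IsCompact ((fun t : ℝ => x - t • unitNormal φ x) '' Set.Icc 0 η) :=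
    isCompact_Icc.image (by fun_prop)
  have h1 := eventually_nhdsSet_iff_forall.2 (Set.forall_mem_image.2 fun t ht =>
    h.eventually_abs_det_fderiv_normalMap_le hN hΩ hΘ hΘd hΘx (η := η) hε hM hHM ht)
  obtain ⟨U, hUo, hKU, hU⟩ := eventually_nhdsSet_iff_exists.1 h1
  obtain ⟨δ, hδ, hδU⟩ := hKc.exists_thickening_subset_open hUo hKU
  exact ⟨δ, hδ, fun w hw => hU w (hδU hw)⟩

/-- If a ball about `z` contained in `Ω` touches the boundary at a point `y` of the chart, then `z`
is the image under the normal map of the point at height `-|y - z|` over the projection of `y`. -/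
theorem normalMap_hyperplaneProj_sub_smul (h : IsC2DefiningFunctionAt Ω x φ)
    {y z : EuclideanSpace ℝ (Fin N)} (hy : IsC2DefiningFunctionAt Ω y φ)
    (hΘ : Θ (hyperplaneProj (unitNormal φ x) x y) = y) (hzy : z ≠ y)
    (hball : ball z (dist y z) ⊆ Ω) :
    hyperplaneProj (unitNormal φ x) x
        (hyperplaneProj (unitNormal φ x) x y - dist y z • unitNormal φ x) =
      hyperplaneProj (unitNormal φ x) x y ∧
    inner ℝ (unitNormal φ x)
        (hyperplaneProj (unitNormal φ x) x y - dist y z • unitNormal φ x - x) = -dist y z ∧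
    normalMap φ Θ x (hyperplaneProj (unitNormal φ x) x y - dist y z • unitNormal φ x) = z := by
  have hπ := h.hyperplaneProj_sub_smul (hyperplaneProj (unitNormal φ x) x y) (dist y z)
  rw [hyperplaneProj_hyperplaneProj h.norm_unitNormal] at hπ
  have hin : inner ℝ (unitNormal φ x)
      (hyperplaneProj (unitNormal φ x) x y - dist y z • unitNormal φ x - x) = -dist y z := by
    rw [sub_right_comm, inner_sub_right, inner_hyperplaneProj_sub h.norm_unitNormal,
      inner_smul_right, real_inner_self_eq_norm_sq, h.norm_unitNormal]
    ring
  refine ⟨hπ, hin, ?_⟩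
  rw [normalMap, hπ, hΘ, hin, neg_smul, hy.unitNormal_eq_of_ball_subset hzy hball]
  abel

/-- The local form of the estimate. The part of the tube over a small piece `A` of the boundary is
covered by the image under the normal map of a set of volume at most `|A| η`: its slices project
into the projection of `A` to the tangent hyperplane, whose measure is at most `|A|`. -/
theorem exists_nhds_volume_innerTube_le (h : IsC2DefiningFunctionAt Ω x φ) (hN : 2 ≤ N)
    (hΩ : IsOpen Ω) {η M ε : ℝ} (hε : 0 < ε) (hM : 0 ≤ M)
    (hHM : -meanCurvature Ω x ≤ M) :
    ∃ V ∈ 𝓝 x, ∀ A ⊆ V, MeasurableSet A → volume (innerTube Ω η A) ≤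
      ENNReal.ofReal ((1 + η * M) ^ (N - 1) + ε) *
        (Measure.euclideanHausdorffMeasure (N - 1) (A ∩ frontier Ω) * ENNReal.ofReal η) := by
  obtain ⟨Θ, hΘc, hΘd, hΘx, hΘp, -, hΘl⟩ := h.exists_chart
  set e := unitNormal φ x with he
  have he1 : ‖e‖ = 1 := h.norm_unitNormal
  set K := (fun t : ℝ => x - t • e) '' Set.Icc 0 η with hK
  obtain ⟨δ₁, hδ₁, hQ⟩ :=
    h.exists_thickening_abs_det_fderiv_normalMap_le hN hΩ hΘc hΘd hΘx (η := η) hε hM hHM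
  obtain ⟨δ₂, hδ₂, hR⟩ := Metric.eventually_nhds_iff_ball.1
    (hΘp.and ((hΘc.eventually (by simp)).mono fun w hw => hw.continuousAt))
  obtain ⟨δ, hδ0, hδ1, hδ2⟩ : ∃ δ > 0, δ ≤ δ₁ ∧ δ ≤ δ₂ :=
    ⟨min δ₁ δ₂, lt_min hδ₁ hδ₂, min_le_left _ _, min_le_right _ _⟩
  obtain ⟨V, hVx, hV⟩ := Filter.eventually_iff_exists_mem.1
    ((Filter.eventually_mem_set.2 (ball_mem_nhds x hδ0)).and
      (hΘl.and ((h.eventually_eq_zero hΩ).and (h.eventually hΩ))))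
  refine ⟨V, hVx, fun A hAV hA => ?_⟩
  have hA' : MeasurableSet (A ∩ frontier Ω) := hA.inter isClosed_frontier.measurableSet
  set Z := hyperplaneProj e x ⁻¹' ball x δ ∩ (fun w => inner ℝ e (w - x)) ⁻¹' Set.Icc (-η) 0
    with hZ
  have hinner : Continuous fun w => inner ℝ e (w - x) := by fun_prop
  have hZm : MeasurableSet Z :=
    (isOpen_ball.preimage (continuous_hyperplaneProj e x)).measurableSet.inter
      (isClosed_Icc.preimage hinner).measurableSet
  have hZQ : Z ⊆ thickening δ₁ K := by
    rintro w ⟨hw1, hw2⟩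
    have h1 : w - (x - (-inner ℝ e (w - x)) • e) = hyperplaneProj e x w - x := by
      rw [hyperplaneProj]
      module
    have hwK : x - (-inner ℝ e (w - x)) • e ∈ K :=
      ⟨-inner ℝ e (w - x), ⟨neg_nonneg.2 hw2.2, neg_le.1 hw2.1⟩, rfl⟩
    have h2 : dist w (x - (-inner ℝ e (w - x)) • e) < δ₁ := by
      rw [dist_eq_norm, h1, ← dist_eq_norm]
      exact (mem_ball.1 (Set.mem_preimage.1 hw1)).trans_le hδ1
    exact mem_thickening_iff.2 ⟨_, hwK, h2⟩
  have hZR : ∀ w ∈ Z, hyperplaneProj e x w ∈ ball x δ₂ := fun w hw =>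
    ball_subset_ball hδ2 hw.1
  -- the part of the cylinder over `A` where the determinant bound is available
  set s := (Z ∩ (fun w => infDist (normalMap φ Θ x w) Ωᶜ + inner ℝ e (w - x)) ⁻¹' Set.Ici 0) ∩
    (Z ∩ (fun w => Θ (hyperplaneProj e x w)) ⁻¹' (A ∩ frontier Ω)) with hs
  have hsm : MeasurableSet s := by
    have h0 : ContinuousOn (normalMap φ Θ x) Z :=
      fun w hw => (hQ w (hZQ hw)).1.continuousAt.continuousWithinAt
    have h1 : ContinuousOn (fun w => infDist (normalMap φ Θ x w) Ωᶜ + inner ℝ e (w - x)) Z :=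
      ((continuous_infDist_pt Ωᶜ).comp_continuousOn h0).add hinner.continuousOn
    have h2 : ContinuousOn (fun w => Θ (hyperplaneProj e x w)) Z :=
      fun w hw => ContinuousAt.continuousWithinAt (ContinuousAt.comp (g := Θ)
        (hR _ (hZR w hw)).2 (continuous_hyperplaneProj e x).continuousAt)
    exact (h1.measurableSet_inter_preimage hZm measurableSet_Ici).inter
      (h2.measurableSet_inter_preimage hZm hA')
  have hvol : volume s ≤
      Measure.euclideanHausdorffMeasure (N - 1) (A ∩ frontier Ω) * ENNReal.ofReal η := by
    have := volume_le_of_slices (x := x) (A := A ∩ frontier Ω) hsm he1 (a := -η) (b := 0)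
      (fun w hw => hw.1.1.2) (fun w hw => ⟨_, hw.2.2, ?_⟩)
    · simpa using this
    · rw [(hR _ (hZR w hw.1.1)).1, hyperplaneProj_hyperplaneProj he1]
  have hcover : innerTube Ω η A ⊆ normalMap φ Θ x '' s := by
    rintro z ⟨hzΩ, hzη, y, hy, hyz⟩
    obtain ⟨hyδ, hyΘ, hy0, hyφ⟩ := hV y (hAV hy.1)
    have hyΩ : y ∉ Ω := by
      have := hy.2
      rw [hΩ.frontier_eq] at this
      exact this.2
    have hzd : dist y z ≤ infDist z Ωᶜ :=
      hyz.trans_le (infDist_frontier_le_infDist_compl hzΩ fun hu => hyΩ (hu ▸ Set.mem_univ y))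
    obtain ⟨hπ, hin, hΦ⟩ := h.normalMap_hyperplaneProj_sub_smul (hyφ hy.2) (hyΘ (hy0 hy.2))
      (fun hzy => hyΩ (hzy ▸ hzΩ)) (ball_subset_of_le_infDist_compl hzd)
    have hwZ : hyperplaneProj e x y - dist y z • e ∈ Z := by
      refine ⟨?_, ?_⟩
      · rw [Set.mem_preimage, hπ, mem_ball]
        have := (lipschitzWith_hyperplaneProj he1 x).dist_le_mul y x
        rw [hyperplaneProj_self, NNReal.coe_one, one_mul] at this
        exact this.trans_lt (mem_ball.1 hyδ)
      · rw [Set.mem_preimage, hin]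
        exact ⟨neg_le_neg (hyz.trans_le hzη), neg_nonpos.2 dist_nonneg⟩
    refine ⟨_, ⟨⟨hwZ, ?_⟩, hwZ, ?_⟩, hΦ⟩
    · rw [Set.mem_preimage, hΦ, hin, Set.mem_Ici]
      linarith
    · rw [Set.mem_preimage, hπ, hyΘ (hy0 hy.2)]
      exact hy
  calc volume (innerTube Ω η A) ≤ volume (normalMap φ Θ x '' s) := measure_mono hcover
    _ ≤ ∫⁻ w in s, ENNReal.ofReal |(fderiv ℝ (normalMap φ Θ x) w).det| :=
        addHaar_image_le_lintegral_abs_det_fderiv volume hsm fun w hw =>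
          (hQ w (hZQ hw.1.1)).1.hasFDerivAt.hasFDerivWithinAt
    _ ≤ ∫⁻ _ in s, ENNReal.ofReal ((1 + η * M) ^ (N - 1) + ε) := by
        refine setLIntegral_mono measurable_const fun w hw => ENNReal.ofReal_le_ofReal ?_
        refine (hQ w (hZQ hw.1.1)).2 ?_
        have := Set.mem_Ici.1 (Set.mem_preimage.1 hw.1.2)
        linarith
    _ = ENNReal.ofReal ((1 + η * M) ^ (N - 1) + ε) * volume s := setLIntegral_const _ _
    _ ≤ _ := by gcongr

/-- The boundary has locally finite measure, being locally a Lipschitz image of a piece of a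
hyperplane. -/
theorem exists_nhds_euclideanHausdorffMeasure_lt_top (h : IsC2DefiningFunctionAt Ω x φ)
    (hΩ : IsOpen Ω) :
    ∃ V ∈ 𝓝 x, Measure.euclideanHausdorffMeasure (N - 1) (V ∩ frontier Ω) < ⊤ := by
  obtain ⟨Θ, hΘc, -, -, -, -, hΘl⟩ := h.exists_chart
  obtain ⟨K, t, ht, hK⟩ := hΘc.exists_lipschitzOnWith
  obtain ⟨r, hr, hrt⟩ := Metric.mem_nhds_iff.1 ht
  set e := unitNormal φ x with he
  have he1 : ‖e‖ = 1 := h.norm_unitNormal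
  have he0 : e ≠ 0 := norm_ne_zero_iff.1 (by simp [he1])
  refine ⟨{y | y ∈ ball x r ∧ (φ y = 0 → Θ (hyperplaneProj e x y) = y) ∧
    (y ∈ frontier Ω → φ y = 0)}, ?_, ?_⟩
  · filter_upwards [ball_mem_nhds x hr, hΘl, h.eventually_eq_zero hΩ] with y hy1 hy2 hy3
    exact ⟨hy1, hy2, hy3⟩
  refine (measure_mono (t := Θ '' ({w | inner ℝ e (w - x) = 0} ∩ ball x r)) ?_).trans_lt
    (((hK.mono (Set.inter_subset_right.trans hrt)).euclideanHausdorffMeasure_image_le _).trans_lt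
      (ENNReal.mul_lt_top (by simp)
        (euclideanHausdorffMeasure_hyperplane_inter_ball_lt_top he0 x r)))
  rintro y ⟨⟨hyr, hyΘ, hy0⟩, hyf⟩
  refine ⟨hyperplaneProj e x y, ⟨inner_hyperplaneProj_sub he1 x y, ?_⟩, hyΘ (hy0 hyf)⟩
  have := (lipschitzWith_hyperplaneProj he1 x).dist_le_mul y x
  rw [hyperplaneProj_self, NNReal.coe_one, one_mul] at this
  exact this.trans_lt (mem_ball.1 hyr)

end IsC2DefiningFunctionAt

theorem innerTube_union (Ω : Set (EuclideanSpace ℝ (Fin N))) (η : ℝ)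
    (A B : Set (EuclideanSpace ℝ (Fin N))) :
    innerTube Ω η (A ∪ B) = innerTube Ω η A ∪ innerTube Ω η B := by
  ext z
  simp only [innerTube, Set.mem_ofPred_eq, Set.mem_union, Set.mem_inter_iff]
  grind

theorem innerTube_frontier (hne : (frontier Ω).Nonempty) (η : ℝ) :
    innerTube Ω η (frontier Ω) = {z ∈ Ω | infDist z (frontier Ω) ≤ η} := by
  ext z
  refine ⟨fun hz => ⟨hz.1, hz.2.1⟩, fun hz => ⟨hz.1, hz.2, ?_⟩⟩
  obtain ⟨y, hy, hyz⟩ := isClosed_frontier.exists_infDist_eq_dist hne z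
  exact ⟨y, ⟨hy, hy⟩, by rw [hyz, dist_comm]⟩

/-- A linear bound on the tubes over small pieces of a compact boundary adds up to a bound on the
whole tube. -/
theorem volume_innerTube_le_of_forall_exists_nhds {c : ENNReal} {η : ℝ}
    (hcomp : IsCompact (frontier Ω))
    (hloc : ∀ x ∈ frontier Ω, ∃ V ∈ 𝓝 x, ∀ A ⊆ V, MeasurableSet A → volume (innerTube Ω η A) ≤
      c * Measure.euclideanHausdorffMeasure (N - 1) (A ∩ frontier Ω)) :
    volume (innerTube Ω η (frontier Ω)) ≤
      c * Measure.euclideanHausdorffMeasure (N - 1) (frontier Ω) := by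
  have key : ∃ S, frontier Ω ⊆ S ∧ MeasurableSet S ∧ ∀ A ⊆ S, MeasurableSet A →
      volume (innerTube Ω η A) ≤
        c * Measure.euclideanHausdorffMeasure (N - 1) (A ∩ frontier Ω) := by
    refine hcomp.induction_on (p := fun T => ∃ S, T ⊆ S ∧ MeasurableSet S ∧
      ∀ A ⊆ S, MeasurableSet A → volume (innerTube Ω η A) ≤
        c * Measure.euclideanHausdorffMeasure (N - 1) (A ∩ frontier Ω)) ?_ ?_ ?_ ?_
    · refine ⟨∅, subset_rfl, MeasurableSet.empty, fun A hA _ => ?_⟩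
      simp [Set.subset_empty_iff.1 hA, innerTube]
    · rintro T T' hTT' ⟨S, hTS, hS⟩
      exact ⟨S, hTT'.trans hTS, hS⟩
    · rintro T T' ⟨S, hTS, hSm, hS⟩ ⟨S', hTS', hSm', hS'⟩
      refine ⟨S ∪ S', Set.union_subset_union hTS hTS', hSm.union hSm', fun A hA hAm => ?_⟩
      rw [← Set.inter_union_sdiff A S, innerTube_union, Set.inter_union_sdiff]
      calc volume (innerTube Ω η (A ∩ S) ∪ innerTube Ω η (A \ S))
          ≤ volume (innerTube Ω η (A ∩ S)) + volume (innerTube Ω η (A \ S)) :=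
            measure_union_le _ _
        _ ≤ c * Measure.euclideanHausdorffMeasure (N - 1) (A ∩ S ∩ frontier Ω) +
            c * Measure.euclideanHausdorffMeasure (N - 1) (A \ S ∩ frontier Ω) :=
            add_le_add (hS _ Set.inter_subset_right (hAm.inter hSm))
              (hS' _ (fun y hy => (hA hy.1).resolve_left hy.2) (hAm.diff hSm))
        _ = c * Measure.euclideanHausdorffMeasure (N - 1) (A ∩ frontier Ω) := by
            rw [← mul_add, ← measure_inter_add_sdiff (A ∩ frontier Ω) hSm, Set.inter_right_comm,
              Set.inter_sdiff_right_comm]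
    · intro x hx
      obtain ⟨V, hV, hVA⟩ := hloc x hx
      obtain ⟨U, hUV, hU, hxU⟩ := _root_.mem_nhds_iff.1 hV
      exact ⟨U, mem_nhdsWithin_of_mem_nhds (hU.mem_nhds hxU), U, subset_rfl, hU.measurableSet,
        fun A hA hAm => hVA A (hA.trans hUV) hAm⟩
  obtain ⟨S, hS, -, h⟩ := key
  simpa using h _ hS isClosed_frontier.measurableSet

end InnerTube

/-! ### The tube estimate -/

theorem lemma2p3 (N : ℕ) (hN : 2 ≤ N) (Ω : Set (EuclideanSpace ℝ (Fin N)))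
    (hopen : IsOpen Ω) (hconn : IsConnected Ω) (hbdd : Bornology.IsBounded Ω)
    (hC2 : HasC2Boundary Ω) :
    IsGreatest (meanCurvatureNeg Ω '' frontier Ω) (maxMeanCurvatureNeg Ω) ∧
    Measure.euclideanHausdorffMeasure (N - 1) (frontier Ω) < ⊤ ∧
    ∀ η : ℝ, 0 < η →
      volume {x ∈ Ω | infDist x (frontier Ω) ≤ η} ≤
        ENNReal.ofReal ((1 + η * maxMeanCurvatureNeg Ω) ^ (N - 1)) *
          Measure.euclideanHausdorffMeasure (N - 1) (frontier Ω) * ENNReal.ofReal η := by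
  have hcomp : IsCompact (frontier Ω) :=
    hbdd.isCompact_closure.of_isClosed_subset isClosed_frontier frontier_subset_closure
  have hne : (frontier Ω).Nonempty := by
    have : Nontrivial (EuclideanSpace ℝ (Fin N)) :=
      Module.nontrivial_of_finrank_pos (R := ℝ) (by rw [finrank_euclideanSpace_fin]; omega)
    refine nonempty_frontier_iff.2 ⟨hconn.nonempty, fun hu => ?_⟩
    exact NormedSpace.unbounded_univ ℝ (EuclideanSpace ℝ (Fin N)) (hu ▸ hbdd)
  have hgreat := hC2.isGreatest_maxMeanCurvatureNeg hopen hbdd hne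
  have hfin : Measure.euclideanHausdorffMeasure (N - 1) (frontier Ω) < ⊤ := by
    refine hcomp.measure_lt_top_of_nhdsWithin fun x hx => ?_
    obtain ⟨φ, h⟩ := hC2.exists_isC2DefiningFunctionAt hopen hx
    obtain ⟨V, hV, hVfin⟩ := h.exists_nhds_euclideanHausdorffMeasure_lt_top hopen
    exact ⟨V ∩ frontier Ω, Filter.inter_mem (mem_nhdsWithin_of_mem_nhds hV) self_mem_nhdsWithin,
      hVfin⟩
  refine ⟨hgreat, hfin, fun η _ => ?_⟩
  have hM : ∀ x ∈ frontier Ω, max (-meanCurvature Ω x) 0 ≤ maxMeanCurvatureNeg Ω := fun x hx =>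
    hgreat.2 (Set.mem_image_of_mem _ hx)
  have hM0 : 0 ≤ maxMeanCurvatureNeg Ω := (le_max_right _ _).trans (hM _ hne.some_mem)
  have hε : ∀ ε > 0, volume {x ∈ Ω | infDist x (frontier Ω) ≤ η} ≤
      ENNReal.ofReal ((1 + η * maxMeanCurvatureNeg Ω) ^ (N - 1) + ε) *
        (Measure.euclideanHausdorffMeasure (N - 1) (frontier Ω) * ENNReal.ofReal η) := by
    intro ε hε
    rw [← innerTube_frontier hne, mul_comm (Measure.euclideanHausdorffMeasure _ _), ← mul_assoc]
    refine volume_innerTube_le_of_forall_exists_nhds hcomp fun x hx => ?_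
    obtain ⟨φ, h⟩ := hC2.exists_isC2DefiningFunctionAt hopen hx
    obtain ⟨V, hV, hVA⟩ := h.exists_nhds_volume_innerTube_le hN hopen (η := η) hε hM0
      ((le_max_left _ _).trans (hM x hx))
    refine ⟨V, hV, fun A hA hAm => (hVA A hA hAm).trans_eq ?_⟩
    rw [mul_comm (Measure.euclideanHausdorffMeasure _ _), ← mul_assoc]
  rw [mul_assoc]
  have hlim : Filter.Tendsto (fun ε : ℝ =>
      ENNReal.ofReal ((1 + η * maxMeanCurvatureNeg Ω) ^ (N - 1) + ε) *
        (Measure.euclideanHausdorffMeasure (N - 1) (frontier Ω) * ENNReal.ofReal η)) (𝓝[>] 0)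
      (𝓝 (ENNReal.ofReal ((1 + η * maxMeanCurvatureNeg Ω) ^ (N - 1)) *
        (Measure.euclideanHausdorffMeasure (N - 1) (frontier Ω) * ENNReal.ofReal η))) := by
    refine ENNReal.Tendsto.mul_const ?_ (Or.inr (ENNReal.mul_ne_top hfin.ne ENNReal.ofReal_ne_top))
    have : Continuous fun ε : ℝ =>
        ENNReal.ofReal ((1 + η * maxMeanCurvatureNeg Ω) ^ (N - 1) + ε) :=
      ENNReal.continuous_ofReal.comp (by fun_prop)
    simpa using this.continuousWithinAt.tendsto (s := Set.Ioi 0) (x := 0)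
  exact ge_of_tendsto hlim (eventually_mem_nhdsWithin.mono hε)
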